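/- For a finite set $A$ of positive integers let $X_A\subset[0,1]$ be the limit set of the maps $T_a(x)=\frac{1}{x+a}$, $a\in A$, that is, $$X_A=\Bigl\{\lim_{n\to\infty}T_{a_1}\circ\cdots\circ T_{a_n}(0) : a_k\in A \text{ for all } k\ge 1\Bigr\},$$ the set of all infinite continued fractions $[0;a_1,a_2,\dots]$ with digits in $A$. Let $D_A$ be the set of integers $q\ge 1$ for which there exist an integer $p\ge 1$ with $\gcd(p,q)=1$, an integer $n\ge 1$ and $a_1,\dots,a_n\in A$ such that $$\frac pq=[0;a_1,\dots,a_n]=\cfrac{1}{a_1+\cfrac{1}{a_2+\cfrac{1}{\ddots+\cfrac{1}{a_n}}}} .$$ If the Hausdorff dimension of $X_A$ satisfies $\dim_H(X_A)>\frac56$, then $A$ has no local obstructions: for every integer $m\ge1$ the reduction map $D_A\to\mathbb Z/m\mathbb Z$, $q\mapsto q \bmod m$, is surjective. -/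

import Mathlib

open Filter Topology

/-- The contraction `T_a(x) = 1 / (x + a)` attached to the digit `a`. -/
noncomputable def digitMap (a : ℕ) (x : ℝ) : ℝ := 1 / (x + a)

/-- The composition `T_{a 0} ∘ T_{a 1} ∘ ⋯ ∘ T_{a (n - 1)}`. -/
noncomputable def digitComp (a : ℕ → ℕ) : ℕ → ℝ → ℝ
  | 0 => id
  | n + 1 => digitComp a n ∘ digitMap (a n)

/-- The limit set `X_A`: all limits `lim_n (T_{a 0} ∘ ⋯ ∘ T_{a (n - 1)}) (0)` over digit
sequences in `A`, that is, all infinite continued fractions `[0; a 0, a 1, …]` with digits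
in `A`. -/
def limitSet (A : Set ℕ) : Set ℝ :=
  {x | ∃ a : ℕ → ℕ, (∀ k, a k ∈ A) ∧ Tendsto (fun n => digitComp a n 0) atTop (𝓝 x)}

/-- The value of the finite continued fraction `[0; a₁, …, aₙ] = 1 / (a₁ + 1 / (a₂ + ⋯))`. -/
def finiteCF : List ℕ → ℚ
  | [] => 0
  | a :: l => 1 / (a + finiteCF l)

/-- The set `D_A` of positive integers `q` for which there are `p` coprime to `q` and
`a₁, …, aₙ ∈ A` with `n ≥ 1` and `p / q = [0; a₁, …, aₙ]`. -/
def cfDenominators (A : Set ℕ) : Set ℕ :=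
  {q | 0 < q ∧ ∃ p : ℕ, 0 < p ∧ Nat.Coprime p q ∧
    ∃ l : List ℕ, l ≠ [] ∧ (∀ a ∈ l, a ∈ A) ∧ (p : ℚ) / (q : ℚ) = finiteCF l}

/-- `A` has no local obstructions: for every `m ≥ 1`, reduction modulo `m` maps the
denominators `D_A` onto `ℤ/m`. -/
def NoLocalObstructions (A : Set ℕ) : Prop :=
  ∀ m : ℕ, 1 ≤ m → (fun q : ℕ => (q : ZMod m)) '' cfDenominators A = Set.univ

/-! Denominators are lower right entries of products of digit matrices. Modulo `m` these matrices
lie in a finite group, so the words also yield inverses, and `digitMatrix_mul_mul` makes the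
available digits closed under `x - y + z`. An odd digit together with two digits at distance 1 or 2
then gives every odd residue as a digit, and words of length at most two realize every residue
(`image_cfDenominators_eq_univ`).

If such digits are missing, then either all digits are even or any two differ by at least 3.
Cylinder covers, measured in a metric that every digit map contracts, show that `∑ digitRatio a ^ (5
/ 3) ≤ 1` forces dimension at most 5/6 (`dimH_limitSet_le`). An integral comparison verifies this
inequality in both cases. -/

/-! ### Continued fractions as matrix products. -/

/-- The matrix of the digit `x`: multiplying column vectors by it realizes `z ↦ 1 / (x + z)`. -/
def digitMatrix {R : Type*} [CommRing R] (x : R) : Matrix (Fin 2) (Fin 2) R := !![0, 1; 1, x]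

/-- Numerator and denominator of `finiteCF`. -/
def cfPair : List ℕ → ℕ × ℕ
  | [] => (0, 1)
  | a :: l => ((cfPair l).2, (cfPair l).1 + a * (cfPair l).2)

theorem cfPair_coprime (l : List ℕ) : Nat.Coprime (cfPair l).1 (cfPair l).2 := by
  induction l with
  | nil => simp [cfPair]
  | cons a l ih => simpa [cfPair] using ih.symm

theorem cfPair_snd_pos {l : List ℕ} (hl : ∀ a ∈ l, 1 ≤ a) : 0 < (cfPair l).2 := by
  induction l with
  | nil => simp [cfPair]
  | cons a l ih =>
    have h := ih fun b hb => hl b (List.mem_cons_of_mem _ hb)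
    have ha := hl a List.mem_cons_self
    simp only [cfPair]
    positivity

theorem finiteCF_eq_cfPair {l : List ℕ} (hl : ∀ a ∈ l, 1 ≤ a) :
    finiteCF l = ((cfPair l).1 : ℚ) / ((cfPair l).2 : ℚ) := by
  induction l with
  | nil => simp [cfPair, finiteCF]
  | cons a l ih =>
    have hl' : ∀ b ∈ l, 1 ≤ b := fun b hb => hl b (List.mem_cons_of_mem _ hb)
    have h : ((cfPair l).2 : ℚ) ≠ 0 := by exact_mod_cast (cfPair_snd_pos hl').ne'
    have h' : (a : ℚ) + (cfPair l).1 / (cfPair l).2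
        = ((cfPair l).1 + a * (cfPair l).2) / (cfPair l).2 := by
      field_simp
      ring
    simp only [finiteCF, cfPair, ih hl', h', one_div_div]
    push_cast
    rfl

theorem cfPair_snd_mem_cfDenominators {A : Set ℕ} (hA : ∀ a ∈ A, 1 ≤ a) {l : List ℕ}
    (hne : l ≠ []) (hl : ∀ a ∈ l, a ∈ A) : (cfPair l).2 ∈ cfDenominators A := by
  have hl' : ∀ a ∈ l, 1 ≤ a := fun a ha => hA a (hl a ha)
  refine ⟨cfPair_snd_pos hl', (cfPair l).1, ?_, cfPair_coprime l, l, hne, hl,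
    (finiteCF_eq_cfPair hl').symm⟩
  obtain _ | ⟨a, l⟩ := l
  · exact absurd rfl hne
  · exact cfPair_snd_pos fun b hb => hl' b (List.mem_cons_of_mem _ hb)

theorem prod_digitMatrix_apply_one {R : Type*} [CommRing R] (l : List ℕ) :
    (l.map fun a : ℕ => digitMatrix (a : R)).prod 0 1 = ((cfPair l).1 : R) ∧
      (l.map fun a : ℕ => digitMatrix (a : R)).prod 1 1 = ((cfPair l).2 : R) := by
  induction l with
  | nil => simp [cfPair]
  | cons a l ih =>
    simp [cfPair, digitMatrix, Matrix.mul_apply, Fin.sum_univ_two] at ih ⊢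
    simp [ih.1, ih.2]

/-- The subsemigroup of matrices that are products of nonempty words of digit matrices. -/
def wordMatrices (A : Set ℕ) (R : Type*) [CommRing R] : Subsemigroup (Matrix (Fin 2) (Fin 2) R) where
  carrier := {M | ∃ l : List ℕ, l ≠ [] ∧ (∀ a ∈ l, a ∈ A) ∧
    (l.map fun a : ℕ => digitMatrix (a : R)).prod = M}
  mul_mem' := by
    rintro _ _ ⟨l, hl, hlA, rfl⟩ ⟨k, hk, hkA, rfl⟩
    refine ⟨l ++ k, by simp [hl], fun a ha => ?_, by simp⟩
    exact (List.mem_append.1 ha).elim (hlA a) (hkA a)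

theorem apply_one_one_mem_image_cfDenominators {A : Set ℕ} (hA : ∀ a ∈ A, 1 ≤ a) {m : ℕ}
    {M : Matrix (Fin 2) (Fin 2) (ZMod m)} (hM : M ∈ wordMatrices A (ZMod m)) :
    M 1 1 ∈ (fun q : ℕ => (q : ZMod m)) '' cfDenominators A := by
  obtain ⟨l, hne, hl, rfl⟩ := hM
  exact ⟨_, cfPair_snd_mem_cfDenominators hA hne hl, (prod_digitMatrix_apply_one l).2.symm⟩

theorem digitMatrix_mem_wordMatrices {A : Set ℕ} {R : Type*} [CommRing R] {a : ℕ} (ha : a ∈ A) :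
    digitMatrix (a : R) ∈ wordMatrices A R :=
  ⟨[a], by simp, by simpa using ha, by simp⟩

/-! ### Digits available modulo `m`. -/

/-- The middle factor is the inverse of `digitMatrix y`. -/
theorem digitMatrix_mul_mul {R : Type*} [CommRing R] (x y z : R) :
    digitMatrix x * !![-y, 1; 1, 0] * digitMatrix z = digitMatrix (x - y + z) := by
  ext i j
  fin_cases i <;> fin_cases j <;> simp [digitMatrix, Matrix.mul_apply, Fin.sum_univ_two]
  ring

theorem digitMatrix_inv {R : Type*} [CommRing R] (y : R) :
    !![-y, 1; 1, 0] * digitMatrix y = 1 ∧ digitMatrix y * !![-y, 1; 1, 0] = 1 := by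
  constructor <;> ext i j <;> fin_cases i <;> fin_cases j <;>
    simp [digitMatrix, Matrix.mul_apply, Fin.sum_univ_two]

theorem digitMatrix_inv_mem {S : Type*} [CommRing S] [Finite S]
    {W : Subsemigroup (Matrix (Fin 2) (Fin 2) S)} {y : S} (hy : digitMatrix y ∈ W) :
    !![-y, 1; 1, 0] ∈ W := by
  let u : (Matrix (Fin 2) (Fin 2) S)ˣ :=
    ⟨digitMatrix y, !![-y, 1; 1, 0], (digitMatrix_inv y).2, (digitMatrix_inv y).1⟩
  have hpow : ∀ n : ℕ, digitMatrix y ^ (n + 1) ∈ W := by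
    intro n
    induction n with
    | zero => simpa using hy
    | succ n ih => rw [pow_succ]; exact mul_mem ih hy
  obtain ⟨n, hn, h1⟩ := (isOfFinOrder_iff_pow_eq_one.1 (isOfFinOrder_of_finite u))
  -- The exponent is `2n - 1`, not `n - 1`, so that it stays positive when `n = 1`: a semigroup need
  -- not contain the empty product.
  have h2 : u⁻¹ = u ^ (2 * n - 2 + 1) := by
    rw [inv_eq_iff_mul_eq_one, ← pow_succ', show 2 * n - 2 + 1 + 1 = n * 2 by omega, pow_mul, h1,
      one_pow]
  have h3 : (!![-y, 1; 1, 0] : Matrix (Fin 2) (Fin 2) S) = digitMatrix y ^ (2 * n - 2 + 1) := by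
    have := congrArg Units.val h2
    simpa [u] using this
  rw [h3]
  exact hpow _

theorem digitMatrix_sub_add_mem {S : Type*} [CommRing S] [Finite S]
    {W : Subsemigroup (Matrix (Fin 2) (Fin 2) S)} {x y z : S} (hx : digitMatrix x ∈ W)
    (hy : digitMatrix y ∈ W) (hz : digitMatrix z ∈ W) : digitMatrix (x - y + z) ∈ W := by
  rw [← digitMatrix_mul_mul]
  exact mul_mem (mul_mem hx (digitMatrix_inv_mem hy)) hz

/-- The integers by which the digits occurring in `W` may be translated. -/
def digitPeriods {S : Type*} [CommRing S] (W : Subsemigroup (Matrix (Fin 2) (Fin 2) S)) :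
    AddSubgroup ℤ where
  carrier := {t | ∀ x : S, digitMatrix x ∈ W → digitMatrix (x + t) ∈ W ∧ digitMatrix (x - t) ∈ W}
  zero_mem' := fun x hx => by simpa using hx
  add_mem' := by
    intro s t hs ht x hx
    have h1 := (ht _ (hs x hx).1).1
    have h2 := (ht _ (hs x hx).2).2
    push_cast
    exact ⟨by rwa [← add_assoc], by rwa [← sub_sub]⟩
  neg_mem' := by
    intro t ht x hx
    push_cast
    exact ⟨by simpa [← sub_eq_add_neg] using (ht x hx).2, by simpa using (ht x hx).1⟩

theorem sub_mem_digitPeriods {S : Type*} [CommRing S] [Finite S]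
    {W : Subsemigroup (Matrix (Fin 2) (Fin 2) S)} {a b : ℕ} (ha : digitMatrix (a : S) ∈ W)
    (hb : digitMatrix (b : S) ∈ W) : (a : ℤ) - b ∈ digitPeriods W := by
  intro x hx
  push_cast
  refine ⟨?_, ?_⟩
  · rw [← add_sub_assoc, add_sub_right_comm]
    exact digitMatrix_sub_add_mem hx hb ha
  · rw [← sub_add]
    exact digitMatrix_sub_add_mem hx ha hb

theorem image_cfDenominators_eq_univ {A : Set ℕ} (hA : ∀ a ∈ A, 1 ≤ a)
    (heven : ∃ a ∈ A, ¬ Even a) (hclose : ∃ a ∈ A, ∃ b ∈ A, a < b ∧ b < a + 3)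
    {m : ℕ} (hm : 1 ≤ m) :
    (fun q : ℕ => (q : ZMod m)) '' cfDenominators A = Set.univ := by
  have : NeZero m := ⟨by omega⟩
  obtain ⟨a, ha, b, hb, hab, hba⟩ := hclose
  have hdiff : (b : ℤ) - a = 1 ∨ (b : ℤ) - a = 2 := by omega
  set W := wordMatrices A (ZMod m)
  have hmem : ∀ a ∈ A, digitMatrix (a : ZMod m) ∈ W := fun a ha => digitMatrix_mem_wordMatrices ha
  have h2 : (2 : ℤ) ∈ digitPeriods W := by
    have h := sub_mem_digitPeriods (hmem b hb) (hmem a ha)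
    obtain h' | h' := hdiff
    · rw [h'] at h
      have h1 := add_mem h h
      rwa [one_add_one_eq_two] at h1
    · rwa [h'] at h
  have hodd : ∀ t : ℤ, digitMatrix (1 + 2 * t : ZMod m) ∈ W := by
    intro t
    obtain ⟨c, hc, hc2⟩ := heven
    obtain ⟨k, rfl⟩ := Nat.not_even_iff_odd.1 hc2
    have h := ((digitPeriods W).zsmul_mem h2 (t - k) _ (hmem _ hc)).1
    push_cast at h
    convert h using 2
    simp only [smul_eq_mul]
    push_cast
    ring
  refine Set.eq_univ_of_forall fun y => ?_
  obtain ⟨n, rfl⟩ := ZMod.intCast_surjective y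
  obtain ⟨k, rfl | rfl⟩ := Int.even_or_odd' n
  -- The lower right entry for the digits 1, 2k - 1 is 1 + (2k - 1) = 2k.
  · have h := mul_mem (hodd 0) (hodd (k - 1))
    have h' := apply_one_one_mem_image_cfDenominators hA h
    convert h' using 1
    simp [digitMatrix, Matrix.mul_apply, Fin.sum_univ_two]
    ring
  · have h' := apply_one_one_mem_image_cfDenominators hA (hodd k)
    convert h' using 1
    simp [digitMatrix]
    ring

/-! ### A metric contracted by every digit map. -/

/-- Up to constants the Euclidean distance on `[0, 1]`, chosen so that every digit map is a
contraction. -/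
noncomputable def mobiusDist (x y : ℝ) : ℝ := |x - y| / ((3 + 2 * x) * (3 + 2 * y))

/-- The contraction ratio of `digitMap a` for `mobiusDist` is the square of this number. -/
noncomputable def digitRatio (a : ℝ) : ℝ := 5 / (3 * a + 5)

theorem digitRatio_pos {a : ℝ} (ha : 0 ≤ a) : 0 < digitRatio a := by
  unfold digitRatio
  positivity

theorem digitRatio_antitone {a b : ℝ} (ha : 0 ≤ a) (hab : a ≤ b) : digitRatio b ≤ digitRatio a := by
  unfold digitRatio
  gcongr

theorem digitMap_mem_Icc {a : ℕ} (ha : 1 ≤ a) {x : ℝ} (hx : x ∈ Set.Icc (0 : ℝ) 1) :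
    digitMap a x ∈ Set.Icc (0 : ℝ) 1 := by
  have ha' : (1 : ℝ) ≤ a := by exact_mod_cast ha
  have hxa : 1 ≤ x + a := by linarith [hx.1]
  exact ⟨by unfold digitMap; positivity, by unfold digitMap; exact div_le_one_of_le₀ hxa (by linarith)⟩

theorem mobiusDist_digitMap {a : ℕ} (ha : 1 ≤ a) {x y : ℝ} (hx : 0 ≤ x) (hy : 0 ≤ y) :
    mobiusDist (digitMap a x) (digitMap a y)
      = |x - y| / ((3 * x + 3 * a + 2) * (3 * y + 3 * a + 2)) := by
  have ha' : (1 : ℝ) ≤ a := by exact_mod_cast ha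
  have hxa : 0 < x + a := by linarith
  have hya : 0 < y + a := by linarith
  have h1 : digitMap a x - digitMap a y = (y - x) / ((x + a) * (y + a)) := by
    unfold digitMap
    field_simp
    ring
  have h2 : 3 + 2 * digitMap a x = (3 * x + 3 * a + 2) / (x + a) := by
    unfold digitMap
    field_simp
  have h3 : 3 + 2 * digitMap a y = (3 * y + 3 * a + 2) / (y + a) := by
    unfold digitMap
    field_simp
  rw [mobiusDist, h1, h2, h3, abs_div, abs_sub_comm y x, abs_of_pos (mul_pos hxa hya)]
  field_simp

/-- The quotient `(3 + 2x) / (3x + 3a + 2)` increases in `x` for `a ≥ 1`, so its maximum is at `x =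
1`. Cross-multiplied, the claim is `(1 - x)(6a - 5) ≥ 0`. -/
theorem inv_le_digitRatio_mul {a x : ℝ} (ha : 1 ≤ a) (hx : x ∈ Set.Icc (0 : ℝ) 1) :
    1 / (3 * x + 3 * a + 2) ≤ digitRatio a * (1 / (3 + 2 * x)) := by
  have hx0 := hx.1
  have hx1 := hx.2
  rw [digitRatio, div_mul_div_comm, div_le_div_iff₀ (by positivity) (by positivity)]
  nlinarith [mul_nonneg (sub_nonneg.2 ha) (sub_nonneg.2 hx1)]

theorem mobiusDist_digitMap_le {a : ℕ} (ha : 1 ≤ a) {x y : ℝ} (hx : x ∈ Set.Icc (0 : ℝ) 1)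
    (hy : y ∈ Set.Icc (0 : ℝ) 1) :
    mobiusDist (digitMap a x) (digitMap a y) ≤ digitRatio a ^ 2 * mobiusDist x y := by
  have ha' : (1 : ℝ) ≤ a := by exact_mod_cast ha
  have hx0 := hx.1
  have hy0 := hy.1
  have h := mul_le_mul (inv_le_digitRatio_mul ha' hx) (inv_le_digitRatio_mul ha' hy)
    (by positivity) (mul_nonneg (digitRatio_pos (by linarith)).le (by positivity))
  calc mobiusDist (digitMap a x) (digitMap a y)
      = |x - y| * (1 / (3 * x + 3 * a + 2) * (1 / (3 * y + 3 * a + 2))) := by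
        rw [mobiusDist_digitMap ha hx0 hy0, div_mul_div_comm, one_mul, mul_one_div]
    _ ≤ |x - y| * (digitRatio a * (1 / (3 + 2 * x)) * (digitRatio a * (1 / (3 + 2 * y)))) := by
        gcongr
    _ = digitRatio a ^ 2 * mobiusDist x y := by
        unfold mobiusDist
        field_simp

theorem digitComp_mem_Icc {a : ℕ → ℕ} {n : ℕ} (ha : ∀ k < n, 1 ≤ a k) {x : ℝ}
    (hx : x ∈ Set.Icc (0 : ℝ) 1) : digitComp a n x ∈ Set.Icc (0 : ℝ) 1 := by
  induction n generalizing x with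
  | zero => exact hx
  | succ n ih =>
    exact ih (fun k hk => ha k (by omega)) (digitMap_mem_Icc (ha n (by omega)) hx)

theorem mobiusDist_digitComp_le {a : ℕ → ℕ} {n : ℕ} (ha : ∀ k < n, 1 ≤ a k) {x y : ℝ}
    (hx : x ∈ Set.Icc (0 : ℝ) 1) (hy : y ∈ Set.Icc (0 : ℝ) 1) :
    mobiusDist (digitComp a n x) (digitComp a n y)
      ≤ (∏ k ∈ Finset.range n, digitRatio (a k) ^ 2) * mobiusDist x y := by
  induction n generalizing x y with
  | zero => simp [digitComp]
  | succ n ih =>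
    have han := ha n (by omega)
    refine (ih (fun k hk => ha k (by omega)) (digitMap_mem_Icc han hx)
      (digitMap_mem_Icc han hy)).trans ?_
    rw [Finset.prod_range_succ, mul_assoc]
    exact mul_le_mul_of_nonneg_left (mobiusDist_digitMap_le han hx hy)
      (Finset.prod_nonneg fun _ _ => sq_nonneg _)

theorem abs_sub_digitComp_le {a : ℕ → ℕ} {n : ℕ} (ha : ∀ k < n, 1 ≤ a k) {x y : ℝ}
    (hx : x ∈ Set.Icc (0 : ℝ) 1) (hy : y ∈ Set.Icc (0 : ℝ) 1) :
    |digitComp a n x - digitComp a n y| ≤ 25 * ∏ k ∈ Finset.range n, digitRatio (a k) ^ 2 := by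
  have h := mobiusDist_digitComp_le ha hx hy
  obtain ⟨hu0, hu1⟩ := digitComp_mem_Icc ha hx
  obtain ⟨hv0, hv1⟩ := digitComp_mem_Icc ha hy
  set u := digitComp a n x
  set v := digitComp a n y
  -- Each factor `3 + 2u`, `3 + 2v` is at most 5.
  have h1 : |u - v| ≤ 25 * mobiusDist u v := by
    rw [mobiusDist, ← mul_div_assoc, le_div_iff₀ (by positivity), mul_comm]
    gcongr
    nlinarith
  have h2 : mobiusDist x y ≤ 1 := by
    have hx0 := hx.1
    have hy0 := hy.1
    rw [mobiusDist, div_le_one (by positivity), abs_le]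
    constructor <;> nlinarith [hx.2, hy.2, mul_nonneg hx0 hy0]
  have h3 : 0 ≤ ∏ k ∈ Finset.range n, digitRatio (a k) ^ 2 :=
    Finset.prod_nonneg fun _ _ => sq_nonneg _
  nlinarith [mul_le_mul_of_nonneg_left h2 h3]

theorem digitComp_congr {a b : ℕ → ℕ} {n : ℕ} (h : ∀ k < n, a k = b k) :
    digitComp a n = digitComp b n := by
  induction n with
  | zero => rfl
  | succ n ih => rw [digitComp, digitComp, ih fun k hk => h k (by omega), h n (by omega)]

theorem digitComp_mem_image {a : ℕ → ℕ} (ha : ∀ k, 1 ≤ a k) {n N : ℕ} (hN : n ≤ N) {x : ℝ}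
    (hx : x ∈ Set.Icc (0 : ℝ) 1) : digitComp a N x ∈ digitComp a n '' Set.Icc (0 : ℝ) 1 := by
  induction N, hN using Nat.le_induction generalizing x with
  | base => exact Set.mem_image_of_mem _ hx
  | succ N _ ih => exact ih (digitMap_mem_Icc (ha N) hx)

/-! ### Cylinder covers and the dimension bound. -/

/-- The digit sequence starting with `w`, continued by zeros. -/
def extendWord {A : Finset ℕ} {n : ℕ} (w : Fin n → A) (k : ℕ) : ℕ :=
  if h : k < n then (w ⟨k, h⟩ : ℕ) else 0

theorem extendWord_val {A : Finset ℕ} {n : ℕ} (w : Fin n → A) (k : Fin n) :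
    extendWord w k = w k := by
  simp [extendWord]

theorem extendWord_pos {A : Finset ℕ} (hA : ∀ a ∈ A, 1 ≤ a) {n : ℕ} (w : Fin n → A) :
    ∀ k < n, 1 ≤ extendWord w k := fun k hk => by
  simpa [extendWord, hk] using hA _ (w ⟨k, hk⟩).2

/-- The closed cylinder of the word `w`. -/
def cylinderSet {A : Finset ℕ} {n : ℕ} (w : Fin n → A) : Set ℝ :=
  closure (digitComp (extendWord w) n '' Set.Icc (0 : ℝ) 1)

theorem limitSet_subset_iUnion_cylinderSet {A : Finset ℕ} (hA : ∀ a ∈ A, 1 ≤ a) (n : ℕ) :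
    limitSet (A : Set ℕ) ⊆ ⋃ w : Fin n → A, cylinderSet w := by
  rintro x ⟨a, haA, hx⟩
  let w : Fin n → A := fun k => ⟨a k, haA k⟩
  refine Set.mem_iUnion.2 ⟨w, mem_closure_of_tendsto hx ?_⟩
  filter_upwards [eventually_ge_atTop n] with N hN
  rw [digitComp_congr (b := a) fun k hk => by simp [extendWord, hk, w]]
  exact digitComp_mem_image (fun k => hA _ (haA k)) hN ⟨le_rfl, zero_le_one⟩

theorem ediam_cylinderSet_le {A : Finset ℕ} (hA : ∀ a ∈ A, 1 ≤ a) {n : ℕ} (w : Fin n → A) :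
    Metric.ediam (cylinderSet w) ≤ ENNReal.ofReal (25 * ∏ k, digitRatio (w k) ^ 2) := by
  rw [cylinderSet, Metric.ediam_closure]
  refine Metric.ediam_le ?_
  rintro _ ⟨x, hx, rfl⟩ _ ⟨y, hy, rfl⟩
  rw [edist_dist, Real.dist_eq]
  refine ENNReal.ofReal_le_ofReal ((abs_sub_digitComp_le (extendWord_pos hA w) hx hy).trans_eq ?_)
  rw [Finset.prod_range]
  simp only [extendWord_val]

theorem digitRatio_nat_le {a : ℕ} (ha : 1 ≤ a) : digitRatio a ≤ 5 / 8 := by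
  have ha' : (1 : ℝ) ≤ a := by exact_mod_cast ha
  refine (digitRatio_antitone zero_le_one ha').trans_eq ?_
  norm_num [digitRatio]

theorem prod_digitRatio_sq_le {A : Finset ℕ} (hA : ∀ a ∈ A, 1 ≤ a) {n : ℕ} (w : Fin n → A) :
    ∏ k, digitRatio (w k) ^ 2 ≤ ((5 / 8) ^ 2 : ℝ) ^ n := by
  refine (Finset.prod_le_prod (g := fun _ => ((5 / 8) ^ 2 : ℝ)) (fun k _ => sq_nonneg _)
    fun k _ => ?_).trans_eq (by simp)
  exact pow_le_pow_left₀ (digitRatio_pos (Nat.cast_nonneg _)).le (digitRatio_nat_le (hA _ (w k).2)) 2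

/-- The cylinders of length `n` cover the limit set and their diameters tend to 0 uniformly. The
5/6-powers of the diameters have sum at most `25 ^ (5 / 6)` for every `n`, so the 5/6-dimensional
Hausdorff measure is finite. -/
theorem dimH_limitSet_le {A : Finset ℕ} (hA : ∀ a ∈ A, 1 ≤ a)
    (hsum : ∑ a ∈ A, digitRatio a ^ (5 / 3 : ℝ) ≤ 1) :
    dimH (limitSet (A : Set ℕ)) ≤ 5 / 6 := by
  have hterm : ∀ (n : ℕ) (w : Fin n → A), Metric.ediam (cylinderSet w) ^ (5 / 6 : ℝ)
      ≤ ENNReal.ofReal (25 ^ (5 / 6 : ℝ) * ∏ k, digitRatio (w k) ^ (5 / 3 : ℝ)) := by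
    intro n w
    have h0 : 0 ≤ ∏ k, digitRatio (w k) ^ 2 := Finset.prod_nonneg fun _ _ => sq_nonneg _
    refine (ENNReal.rpow_le_rpow (ediam_cylinderSet_le hA w) (by norm_num)).trans_eq ?_
    rw [ENNReal.ofReal_rpow_of_nonneg (by positivity) (by norm_num),
      Real.mul_rpow (by norm_num) h0, ← Real.finsetProd_rpow _ _ fun _ _ => sq_nonneg _]
    congr 2
    refine Finset.prod_congr rfl fun k _ => ?_
    rw [← Real.rpow_natCast, ← Real.rpow_mul (digitRatio_pos (Nat.cast_nonneg _)).le]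
    norm_num
  have hbound : ∀ n : ℕ, ∑ w : Fin n → A, Metric.ediam (cylinderSet w) ^ (5 / 6 : ℝ)
      ≤ ENNReal.ofReal (25 ^ (5 / 6 : ℝ)) := by
    intro n
    have hnn : ∀ a : ℕ, 0 ≤ digitRatio a ^ (5 / 3 : ℝ) := fun a =>
      Real.rpow_nonneg (digitRatio_pos (Nat.cast_nonneg _)).le _
    refine (Finset.sum_le_sum fun w _ => hterm n w).trans ?_
    rw [← ENNReal.ofReal_sum_of_nonneg fun w _ =>
      mul_nonneg (by positivity) (Finset.prod_nonneg fun k _ => hnn _), ← Finset.mul_sum]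
    refine ENNReal.ofReal_le_ofReal (mul_le_of_le_one_right (by positivity) ?_)
    -- The sum over words of length `n` is the `n`-th power of the sum over digits.
    rw [← Fintype.sum_pow (fun a : A => digitRatio (a : ℕ) ^ (5 / 3 : ℝ)) n]
    refine pow_le_one₀ (Finset.sum_nonneg fun a _ => hnn _) ?_
    rwa [Finset.sum_coe_sort A fun a : ℕ => digitRatio a ^ (5 / 3 : ℝ)]
  have hr : Tendsto (fun n : ℕ => ENNReal.ofReal (25 * ((5 / 8) ^ 2 : ℝ) ^ n)) atTop (𝓝 0) := by
    have h := (tendsto_pow_atTop_nhds_zero_of_lt_one (r := ((5 / 8) ^ 2 : ℝ)) (by norm_num)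
      (by norm_num)).const_mul 25
    simpa using ENNReal.tendsto_ofReal h
  have hmeas := MeasureTheory.Measure.hausdorffMeasure_le_liminf_sum (5 / 6 : ℝ)
    (limitSet (A : Set ℕ)) _ hr (fun n (w : Fin n → A) => cylinderSet w)
    (Eventually.of_forall fun n w => (ediam_cylinderSet_le hA w).trans
      (ENNReal.ofReal_le_ofReal (mul_le_mul_of_nonneg_left (prod_digitRatio_sq_le hA w)
        (by norm_num))))
    (Eventually.of_forall fun n => limitSet_subset_iUnion_cylinderSet hA n)
  have hle : MeasureTheory.Measure.hausdorffMeasure (5 / 6 : ℝ) (limitSet (A : Set ℕ))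
      ≤ ENNReal.ofReal (25 ^ (5 / 6 : ℝ)) :=
    hmeas.trans ((liminf_le_liminf (Eventually.of_forall hbound)).trans_eq (liminf_const _))
  have hdim := dimH_le_of_hausdorffMeasure_ne_top (d := (5 / 6 : NNReal))
    (s := limitSet (A : Set ℕ)) (by
      push_cast
      exact ne_top_of_le_ne_top ENNReal.ofReal_ne_top hle)
  refine hdim.trans_eq ?_
  rw [ENNReal.coe_div (by norm_num)]
  norm_num

/-! ### Estimating the sum over digits. -/

/-- Discrete integral comparison: the derivative of `digitRatio ^ (2 / 3)` is `-(2 / 5) * digitRatio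
^ (5 / 3)`. Bernoulli's inequality replaces the integral. -/
theorem digitRatio_rpow_le_sub {a d : ℝ} (ha : 0 ≤ a) (hd : 0 < d) :
    digitRatio (a + d) ^ (5 / 3 : ℝ)
      ≤ 5 / (2 * d) * (digitRatio a ^ (2 / 3 : ℝ) - digitRatio (a + d) ^ (2 / 3 : ℝ)) := by
  have hx := digitRatio_pos ha
  have hy := digitRatio_pos (add_nonneg ha hd.le)
  have hxy : digitRatio (a + d) = digitRatio a * (1 + -(3 * d / 5 * digitRatio (a + d))) := by
    unfold digitRatio
    field_simp
    ring
  have hz : 3 * d / 5 * digitRatio (a + d) ≤ 1 := by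
    by_contra h
    nlinarith
  set x := digitRatio a
  set y := digitRatio (a + d)
  have hB := rpow_one_add_le_one_add_mul_self (s := -(3 * d / 5 * y)) (by linarith)
    (p := 2 / 3) (by norm_num) (by norm_num)
  have hy23 : y ^ (2 / 3 : ℝ) ≤ x ^ (2 / 3 : ℝ) * (1 - 2 * d / 5 * y) := by
    rw [hxy, Real.mul_rpow hx.le (by linarith), ← hxy]
    refine mul_le_mul_of_nonneg_left (hB.trans_eq (by ring)) (by positivity)
  have hy53 : y ^ (5 / 3 : ℝ) = y ^ (2 / 3 : ℝ) * y := by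
    rw [← Real.rpow_add_one hy.ne']
    norm_num
  have hX : 0 < x ^ (2 / 3 : ℝ) := by positivity
  have hY : 0 < y ^ (2 / 3 : ℝ) := by positivity
  have hYX : y ^ (2 / 3 : ℝ) ≤ x ^ (2 / 3 : ℝ) := by
    refine hy23.trans (mul_le_of_le_one_right hX.le ?_)
    have : 0 < d * y := by positivity
    linarith
  rw [hy53, div_mul_eq_mul_div, le_div_iff₀ (by positivity)]
  have h1 : d * y * y ^ (2 / 3 : ℝ) ≤ d * y * x ^ (2 / 3 : ℝ) := by gcongr
  linarith

/-- The tail telescopes. Two terms are kept exact because keeping only one would push the bound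
above 1 in both applications. -/
theorem sum_range_digitRatio_rpow_le {r d : ℝ} (hr : 0 ≤ r) (hd : 0 < d) (N : ℕ) :
    ∑ k ∈ Finset.range N, digitRatio (r + d * k) ^ (5 / 3 : ℝ)
      ≤ digitRatio r ^ (5 / 3 : ℝ) + digitRatio (r + d) ^ (5 / 3 : ℝ)
        + 5 / (2 * d) * digitRatio (r + d) ^ (2 / 3 : ℝ) := by
  have hF : ∀ {a : ℝ}, 0 ≤ a → ∀ p : ℝ, 0 ≤ digitRatio a ^ p := fun ha p =>
    Real.rpow_nonneg (digitRatio_pos ha).le p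
  have hstrong : ∀ n : ℕ, ∑ k ∈ Finset.range (n + 2), digitRatio (r + d * k) ^ (5 / 3 : ℝ)
      ≤ digitRatio r ^ (5 / 3 : ℝ) + digitRatio (r + d) ^ (5 / 3 : ℝ)
        + 5 / (2 * d) * (digitRatio (r + d) ^ (2 / 3 : ℝ)
          - digitRatio (r + d * (n + 1 : ℕ)) ^ (2 / 3 : ℝ)) := by
    intro n
    induction n with
    | zero => simp [Finset.sum_range_succ]
    | succ n ih =>
      rw [Finset.sum_range_succ]
      have h := digitRatio_rpow_le_sub (a := r + d * (n + 1 : ℕ)) (by positivity) hd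
      rw [show r + d * (n + 1 : ℕ) + d = r + d * (n + 1 + 1 : ℕ) by push_cast; ring] at h
      linarith
  calc ∑ k ∈ Finset.range N, digitRatio (r + d * k) ^ (5 / 3 : ℝ)
      ≤ ∑ k ∈ Finset.range (N + 2), digitRatio (r + d * k) ^ (5 / 3 : ℝ) :=
        Finset.sum_le_sum_of_subset_of_nonneg (Finset.range_mono (by omega))
          fun k _ _ => hF (by positivity) _
    _ ≤ _ := hstrong N
    _ ≤ _ := by
        have := hF (a := r + d * (N + 1 : ℕ)) (by positivity) (2 / 3)
        gcongr
        linarith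

/-- Rounding each digit down to the progression `r + d * k` only increases its ratio, and
injectivity prevents repeated terms. -/
theorem sum_digitRatio_rpow_le {A : Finset ℕ} {r d : ℕ} (hd : 0 < d) (hr : ∀ a ∈ A, r ≤ a)
    (hinj : Set.InjOn (fun a => (a - r) / d) (A : Set ℕ)) :
    ∑ a ∈ A, digitRatio a ^ (5 / 3 : ℝ)
      ≤ digitRatio r ^ (5 / 3 : ℝ) + digitRatio (r + d) ^ (5 / 3 : ℝ)
        + 5 / (2 * d) * digitRatio (r + d) ^ (2 / 3 : ℝ) := by
  have hd' : (0 : ℝ) < d := by exact_mod_cast hd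
  obtain ⟨N, hN⟩ := (A.image fun a => (a - r) / d).exists_nat_subset_range
  calc ∑ a ∈ A, digitRatio a ^ (5 / 3 : ℝ)
      ≤ ∑ a ∈ A, digitRatio (r + d * ((a - r) / d : ℕ)) ^ (5 / 3 : ℝ) := by
        refine Finset.sum_le_sum fun a ha => ?_
        refine Real.rpow_le_rpow (digitRatio_pos (Nat.cast_nonneg _)).le
          (digitRatio_antitone (by positivity) ?_) (by norm_num)
        have h1 := Nat.mul_div_le (a - r) d
        have h2 := hr a ha
        exact_mod_cast (by omega : r + d * ((a - r) / d) ≤ a)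
    _ = ∑ k ∈ A.image fun a => (a - r) / d, digitRatio (r + d * k) ^ (5 / 3 : ℝ) :=
        (Finset.sum_image (f := fun k : ℕ => digitRatio (r + d * k) ^ (5 / 3 : ℝ)) hinj).symm
    _ ≤ ∑ k ∈ Finset.range N, digitRatio (r + d * k) ^ (5 / 3 : ℝ) :=
        Finset.sum_le_sum_of_subset_of_nonneg hN fun k _ _ =>
          Real.rpow_nonneg (digitRatio_pos (by positivity)).le _
    _ ≤ _ := sum_range_digitRatio_rpow_le (Nat.cast_nonneg _) hd' N

/-- Reduces bounds on fractional powers to rational arithmetic by cubing. -/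
theorem rpow_div_three_le {x y : ℝ} (hx : 0 ≤ x) (hy : 0 ≤ y) {n : ℕ} (h : x ^ n ≤ y ^ 3) :
    x ^ (n / 3 : ℝ) ≤ y := by
  have h1 : x ^ (n / 3 : ℝ) = (x ^ n) ^ (1 / 3 : ℝ) := by
    rw [← Real.rpow_natCast x n, ← Real.rpow_mul hx]
    ring_nf
  have h2 : (y ^ 3) ^ (1 / 3 : ℝ) = y := by
    rw [← Real.rpow_natCast y 3, ← Real.rpow_mul hy]
    norm_num
  rw [h1, ← h2]
  exact Real.rpow_le_rpow (by positivity) h (by norm_num)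

theorem digitRatio_rpow_bounds :
    digitRatio 1 ^ (5 / 3 : ℝ) ≤ 46 / 100 ∧ digitRatio 2 ^ (5 / 3 : ℝ) ≤ 27 / 100 ∧
      digitRatio 4 ^ (5 / 3 : ℝ) ≤ 131 / 1000 ∧ digitRatio 4 ^ (2 / 3 : ℝ) ≤ 443 / 1000 := by
  have h5 : (5 / 3 : ℝ) = (5 : ℕ) / 3 := by norm_num
  have h2 : (2 / 3 : ℝ) = (2 : ℕ) / 3 := by norm_num
  rw [h5, h2]
  unfold digitRatio
  refine ⟨?_, ?_, ?_, ?_⟩ <;>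
    exact rpow_div_three_le (by norm_num) (by norm_num) (by norm_num)

theorem dimH_limitSet_le_of_even {A : Finset ℕ} (hA : ∀ a ∈ A, 1 ≤ a) (heven : ∀ a ∈ A, Even a) :
    dimH (limitSet (A : Set ℕ)) ≤ 5 / 6 := by
  have h2 : ∀ a ∈ A, 2 ≤ a := fun a ha => by
    have := hA a ha
    obtain ⟨k, rfl⟩ := heven a ha
    omega
  refine dimH_limitSet_le hA ((sum_digitRatio_rpow_le (r := 2) (d := 2) two_pos h2 ?_).trans ?_)
  · intro a ha b hb hab
    obtain ⟨k, rfl⟩ := heven a ha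
    obtain ⟨l, rfl⟩ := heven b hb
    have := h2 _ ha
    have := h2 _ hb
    simp only at hab
    omega
  · obtain ⟨-, b2, b4, b4'⟩ := digitRatio_rpow_bounds
    norm_num at b2 b4 b4' ⊢
    linarith

theorem dimH_limitSet_le_of_sparse {A : Finset ℕ} (hA : ∀ a ∈ A, 1 ≤ a)
    (hsparse : ∀ a ∈ A, ∀ b ∈ A, a < b → a + 3 ≤ b) :
    dimH (limitSet (A : Set ℕ)) ≤ 5 / 6 := by
  refine dimH_limitSet_le hA ((sum_digitRatio_rpow_le (r := 1) (d := 3) three_pos hA ?_).trans ?_)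
  -- Each block `{3k + 1, 3k + 2, 3k + 3}` contains at most one digit.
  · intro a ha b hb hab
    have h1 := hA a ha
    have h2 := hA b hb
    have h3 := hsparse a ha b hb
    have h4 := hsparse b hb a ha
    simp only at hab
    omega
  · obtain ⟨b1, -, b4, b4'⟩ := digitRatio_rpow_bounds
    norm_num at b1 b4 b4' ⊢
    linarith

theorem mainTheorem10 (A : Finset ℕ) (hpos : ∀ a ∈ A, 1 ≤ a)
    (hdim : (5 / 6 : ENNReal) < dimH (limitSet (A : Set ℕ))) :
    NoLocalObstructions (A : Set ℕ) := by
  intro m hm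
  refine image_cfDenominators_eq_univ hpos ?_ ?_ hm
  · by_contra! h
    exact hdim.not_ge (dimH_limitSet_le_of_even hpos h)
  · by_contra! h
    exact hdim.not_ge (dimH_limitSet_le_of_sparse hpos h)
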